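/- Let $\mathcal E$ be a completely positive trace-preserving linear map on $M_d(\mathbb C)$, $d\ge 1$, and let $|\psi^+\rangle = d^{-1/2}\sum_i |i\rangle\otimes|i\rangle$. For a Kraus representation $\mathcal E(\rho)=\sum_i M_i\rho M_i^\dagger$ put $p_i=\|(M_i\otimes 1)\psi^+\|^2$ and $\psi_i=p_i^{-1/2}(M_i\otimes 1)\psi^+$ (with $\psi_i=0$ if $p_i=0$). The representation is called diagonal if $\mathrm{tr}(M_\mu^\dagger M_\nu)=0$ for $\mu\ne\nu$. Let $W=(\mathcal E\otimes\mathrm{id})(|\psi^+\rangle\langle\psi^+|)$ be the Choi state, and let $S_{\mathcal E}=-\sum_\lambda\lambda\log_2\lambda$, the sum being over the eigenvalues of $W$ with multiplicity ($0\log_2 0=0$). A storage code for $n$ uses with $m$ qubits is a pair consisting of a completely positive trace-preserving map from the operators on $n$ pairs of $d$-level systems to those on $(\mathbb C^2)^{\otimes m}$ (the encoding) and one in the opposite direction (the decoding). It is $\varepsilon$-faithful for $\mathcal E$ if, for all choices of (finite) Kraus representations $(M^{(t)}_i)_i$ of $\mathcal E$, $t=1,\dots,n$, one for each use, the following average fidelity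 is at least $1-\varepsilon$: for a sequence $x=(x_1,\dots,x_n)$ of outcomes put $p_x=\prod_t p^{(t)}_{x_t}$ and $\psi_x=\bigotimes_t\psi^{(t)}_{x_t}$; encode and decode $|\psi_x\rangle\langle\psi_x|$ to obtain a state $\sigma_x$; the average fidelity is $\sum_x p_x\langle\psi_x|\sigma_x|\psi_x\rangle$. (The code does not depend on the Kraus representations.) A rate $R\in\mathbb R$ is achievable if for every $\varepsilon>0$ and all sufficiently large $n$ there is an $\varepsilon$-faithful code for $n$ uses with $m\le nR$ qubits. Then: 1. $\mathcal E$ has a diagonal Kraus representation. 2. For every diagonal Kraus representation $(M_\mu)$ of $\mathcal E$: $\sum_\mu p_\mu=1$, the $\psi_\mu$ are pairwise orthogonal, $W=\sum_\mu p_\mu|\psi_\mu\rangle\langle\psi_\mu|$, the nonzero $p_\mu$ are the nonzero eigenvalues of $W$ with multiplicity, and $S_{\mathcal E}=-\sum_\mu p_\mu\log_2 p_\mu$. 3. $S_{\mathcal E}$ is the optimal asymptotic rate, in qubits per use, at which the Kraus sequences of $\mathcal E$ can be faithfully stored: it is the infimum of the achievable rates. 4. The converse holds already for a diagonal ensemble: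 if $(M_\mu)$ is a diagonal Kraus representation of $\mathcal E$ and $R<S_{\mathcal E}$, there is $\varepsilon>0$ such that for all sufficiently large $n$, all $m\le nR$, all assignments of $m$-qubit density matrices $\tau_x$ to the sequences $x=(\mu_1,\dots,\mu_n)$, and all completely positive trace-preserving decodings $D$, with $p_x=\prod_t p_{\mu_t}$ and $\psi_x=\bigotimes_t\psi_{\mu_t}$, one has $\sum_x p_x\langle\psi_x|D(\tau_x)|\psi_x\rangle\le 1-\varepsilon$. -/

import Mathlib

open Matrix Filter
open scoped Kronecker ComplexOrder

/-- The ampliation `Φ ⊗ id` of a linear map `Φ` between matrix algebras, acting on the first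
tensor factor. -/
def ampliation {a b k : Type*} (Φ : Matrix a a ℂ →ₗ[ℂ] Matrix b b ℂ)
    (X : Matrix (a × k) (a × k) ℂ) : Matrix (b × k) (b × k) ℂ :=
  Matrix.of fun p q => Φ (Matrix.of fun i j => X (i, p.2) (j, q.2)) p.1 q.1

/-- Completely positive and trace preserving maps between matrix algebras: every ampliation
`Φ ⊗ id_k` maps positive semidefinite matrices to positive semidefinite matrices, and
`tr Φ(X) = tr X`. -/
structure IsCPTP {a b : Type*} [Fintype a] [Fintype b]
    (Φ : Matrix a a ℂ →ₗ[ℂ] Matrix b b ℂ) : Prop where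
  completely_positive : ∀ (k : ℕ) (X : Matrix (a × Fin k) (a × Fin k) ℂ),
    X.PosSemidef → (ampliation Φ X).PosSemidef
  trace_preserving : ∀ X : Matrix a a ℂ, (Φ X).trace = X.trace

/-- Density matrices. -/
structure IsDensity {a : Type*} [Fintype a] (ρ : Matrix a a ℂ) : Prop where
  posSemidef : ρ.PosSemidef
  trace_eq_one : ρ.trace = 1

section OneUse

variable {d : Type*} [Fintype d] [DecidableEq d]

/-- `(M i)` is a Kraus representation of `E`: `E ρ = ∑ i, M i ρ (M i)†`. -/
def IsKraus {ι : Type*} [Fintype ι] (E : Matrix d d ℂ →ₗ[ℂ] Matrix d d ℂ)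
    (M : ι → Matrix d d ℂ) : Prop :=
  ∀ ρ : Matrix d d ℂ, E ρ = ∑ i, M i * ρ * (M i)ᴴ

/-- A diagonal Kraus representation: the Kraus operators are pairwise orthogonal in the trace
inner product. -/
structure IsDiagonalKraus {ι : Type*} [Fintype ι] (E : Matrix d d ℂ →ₗ[ℂ] Matrix d d ℂ)
    (M : ι → Matrix d d ℂ) : Prop where
  isKraus : IsKraus E M
  trace_orthogonal : ∀ i j, i ≠ j → ((M i)ᴴ * M j).trace = 0

/-- The maximally entangled state vector `ψ⁺ = |d|^(-1/2) ∑ i, |i⟩ ⊗ |i⟩`. -/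
noncomputable def maxEntangled (d : Type*) [Fintype d] [DecidableEq d] : d × d → ℂ :=
  fun p => if p.1 = p.2 then ((√(Fintype.card d : ℝ))⁻¹ : ℝ) else 0

/-- The Choi state: `E` acts on the first half of `ψ⁺`. -/
noncomputable def choiState (E : Matrix d d ℂ →ₗ[ℂ] Matrix d d ℂ) : Matrix (d × d) (d × d) ℂ :=
  ampliation E (vecMulVec (maxEntangled d) (star (maxEntangled d)))

/-- The entropy (in bits) of the map `E`: `-∑ p log₂ p` over the spectrum of the Choi state,
counted with multiplicity. -/
noncomputable def mapEntropy (E : Matrix d d ℂ →ₗ[ℂ] Matrix d d ℂ) : ℝ :=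
  -((choiState E).charpoly.roots.map fun z : ℂ => z.re * Real.logb 2 z.re).sum

/-- The unnormalized vector `(M ⊗ 1) ψ⁺`. -/
noncomputable def krausVec (M : Matrix d d ℂ) : d × d → ℂ :=
  (M ⊗ₖ (1 : Matrix d d ℂ)) *ᵥ maxEntangled d

/-- The probability `‖(M ⊗ 1) ψ⁺‖²` of the Kraus operator `M` acting on half of `ψ⁺`. -/
noncomputable def krausWeight (M : Matrix d d ℂ) : ℝ :=
  ∑ p, ‖krausVec M p‖ ^ 2

/-- The normalized vector `(M ⊗ 1) ψ⁺ / ‖(M ⊗ 1) ψ⁺‖` (and `0` if `M = 0`). -/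
noncomputable def krausState (M : Matrix d d ℂ) : d × d → ℂ :=
  ((√(krausWeight M))⁻¹ : ℝ) • krausVec M

end OneUse

/-- The fidelity `⟨v| ρ |v⟩` of a state `ρ` with a pure state `v`. -/
noncomputable def pureFidelity {a : Type*} [Fintype a] (v : a → ℂ) (ρ : Matrix a a ℂ) : ℝ :=
  (star v ⬝ᵥ (ρ *ᵥ v)).re

section ManyUses

variable {d : Type*} [Fintype d] [DecidableEq d]

/-- The operator `M 0 ⊗ ⋯ ⊗ M (n-1)` on `n` copies of the system, whose basis is indexed by
`Fin n → d`.  Since `ψ⁺` for the index type `Fin n → d` is the `n`-fold tensor power of `ψ⁺` for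
`d` (with the tensor factors regrouped), `krausState (tensorOp M)` is the tensor product of the
`krausState (M t)`. -/
def tensorOp {n : ℕ} (M : Fin n → Matrix d d ℂ) : Matrix (Fin n → d) (Fin n → d) ℂ :=
  Matrix.of fun i j => ∏ t, M t (i t) (j t)

/-- A (blind) storage code for `n` uses with a memory of `m` qubits: a quantum operation from the
`n` halves-acted-on maximally entangled pairs to the memory, and a quantum operation back. It sees
only the state, not the Kraus representation used by the source or the source's outcomes. -/
structure StorageCode (d : Type*) [Fintype d] [DecidableEq d] (n m : ℕ) where
  encode : Matrix ((Fin n → d) × (Fin n → d)) ((Fin n → d) × (Fin n → d)) ℂ →ₗ[ℂ]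
    Matrix (Fin (2 ^ m)) (Fin (2 ^ m)) ℂ
  decode : Matrix (Fin (2 ^ m)) (Fin (2 ^ m)) ℂ →ₗ[ℂ]
    Matrix ((Fin n → d) × (Fin n → d)) ((Fin n → d) × (Fin n → d)) ℂ
  encode_cptp : IsCPTP encode
  decode_cptp : IsCPTP decode

/-- The average fidelity in the following test.  The source implements the `t`-th use of the map
with the Kraus operators `M t`, on half of `ψ⁺`, and reads out the outcome `x t`; this produces
`⨂ₜ (M t (x t) ⊗ 1) ψ⁺`, which is encoded and decoded; the source announces `x`, and the
decoded state is tested against the state that the announced Kraus sequence produced. -/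
noncomputable def StorageCode.averageFidelity {n m r : ℕ} (C : StorageCode d n m)
    (M : Fin n → Fin r → Matrix d d ℂ) : ℝ :=
  ∑ x : Fin n → Fin r,
    krausWeight (tensorOp fun t => M t (x t)) *
      pureFidelity (krausState (tensorOp fun t => M t (x t)))
        (C.decode (C.encode (vecMulVec (krausState (tensorOp fun t => M t (x t)))
          (star (krausState (tensorOp fun t => M t (x t)))))))

/-- The code stores the Kraus sequences of `n` uses of `E` with error at most `ε`, whatever Kraus
representations of `E` the source chooses (possibly a different one at each use). -/
def StorageCode.IsFaithful {n m : ℕ} (C : StorageCode d n m)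
    (E : Matrix d d ℂ →ₗ[ℂ] Matrix d d ℂ) (ε : ℝ) : Prop :=
  ∀ (r : ℕ) (M : Fin n → Fin r → Matrix d d ℂ), (∀ t, IsKraus E (M t)) →
    1 - ε ≤ C.averageFidelity M

/-- `R` qubits per use suffice asymptotically: for every error `ε > 0` and all large `n` there is
an `ε`-faithful code for `n` uses with at most `n R` qubits of memory. -/
def IsAchievableRate (E : Matrix d d ℂ →ₗ[ℂ] Matrix d d ℂ) (R : ℝ) : Prop :=
  ∀ ε : ℝ, 0 < ε → ∀ᶠ n : ℕ in atTop, ∃ m : ℕ, (m : ℝ) ≤ n * R ∧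
    ∃ C : StorageCode d n m, C.IsFaithful E ε

end ManyUses

/-!
Writing the Choi state of a Kraus representation as `W = V * Vᴴ`, the columns of `V` being the
vectors `krausVec (M k)`, its nonzero spectrum is that of the Gram matrix `Vᴴ * V`, which is
diagonal exactly when the representation is.

The average `∑ k, p k * ⟨ψ k| X |ψ k⟩ = tr (X W)` of an observable `X` depends only on the map.
Hence the projection onto the likely vectors of one diagonal representation of the `n`-fold tensor
power of the map, compressed into the memory as in Schumacher's coding theorem, serves all Kraus
sequences at once: if it has fidelity `f` with a vector, the decoded state has fidelity at least
`f ^ 2 ≥ 2 * f - 1`, a bound that is linear in `f` and can be averaged. For the converse, a decoding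
`D` satisfies `D τ ≤ D 1`; sequences of probability above `c` have negligible total weight, and by
Bessel's inequality the others contribute at most `c` times the dimension of the memory. Chernoff's
exponential moment bounds the weight of the atypical sequences in both directions.
-/

section TypicalSequences

open scoped Topology

variable {ι : Type*} [Fintype ι] {p f : ι → ℝ}

theorem exists_pos_sum_mul_exp_lt_one (hp : ∑ i, p i = 1) (hf : ∑ i, p i * f i < 0) :
    ∃ s : ℝ, 0 < s ∧ ∑ i, p i * Real.exp (s * f i) < 1 := by
  have hderiv : HasDerivAt (fun s : ℝ => ∑ i, p i * Real.exp (s * f i)) (∑ i, p i * f i) 0 := by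
    have hterm (i : ι) : HasDerivAt (fun s : ℝ => p i * Real.exp (s * f i)) (p i * f i) 0 := by
      simpa using ((hasDerivAt_mul_const (f i)).exp.const_mul (p i) : HasDerivAt _ _ (0 : ℝ))
    exact HasDerivAt.fun_sum fun i _ => hterm i
  obtain ⟨s, hslope, hs⟩ := ((hderiv.hasDerivWithinAt.limsup_slope_le'
    (Set.notMem_Ioi.2 le_rfl) hf).and self_mem_nhdsWithin).exists
  refine ⟨s, hs, ?_⟩
  rw [slope_def_field, sub_zero, div_neg_iff] at hslope
  simpa [hp, not_lt_of_gt (show 0 < s from hs), show 0 < s from hs] using hslope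

theorem tendsto_sum_prod_of_sum_mul_neg (hp₀ : ∀ i, 0 ≤ p i) (hp : ∑ i, p i = 1)
    (hf : ∑ i, p i * f i < 0) {P : ∀ n : ℕ, (Fin n → ι) → Prop} [∀ n, DecidablePred (P n)]
    (hP : ∀ n x, ∏ t, p (x t) ≠ 0 → P n x → 0 ≤ ∑ t, f (x t)) :
    Tendsto (fun n : ℕ => ∑ x : Fin n → ι with P n x, ∏ t, p (x t)) atTop (𝓝 0) := by
  obtain ⟨s, hs, hlt⟩ := exists_pos_sum_mul_exp_lt_one hp hf
  have hprod (n : ℕ) (x : Fin n → ι) : 0 ≤ ∏ t, p (x t) := Finset.prod_nonneg fun t _ => hp₀ _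
  have hmarkov (n : ℕ) (x : Fin n → ι) (hx : P n x) :
      ∏ t, p (x t) ≤ (∏ t, p (x t)) * Real.exp (s * ∑ t, f (x t)) := by
    rcases eq_or_ne (∏ t, p (x t)) 0 with hzero | hne
    · rw [hzero, zero_mul]
    · exact le_mul_of_one_le_right (hprod n x) (Real.one_le_exp (mul_nonneg hs.le (hP n x hne hx)))
  have hchernoff (n : ℕ) : ∑ x : Fin n → ι with P n x, ∏ t, p (x t) ≤
      (∑ i, p i * Real.exp (s * f i)) ^ n := by
    calc ∑ x : Fin n → ι with P n x, ∏ t, p (x t)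
        ≤ ∑ x : Fin n → ι with P n x, (∏ t, p (x t)) * Real.exp (s * ∑ t, f (x t)) :=
          Finset.sum_le_sum fun x hx => hmarkov n x (Finset.mem_filter.1 hx).2
      _ ≤ ∑ x : Fin n → ι, (∏ t, p (x t)) * Real.exp (s * ∑ t, f (x t)) :=
          Finset.sum_le_univ_sum_of_nonneg fun x => mul_nonneg (hprod n x) (Real.exp_nonneg _)
      _ = (∑ i, p i * Real.exp (s * f i)) ^ n := by
          simp only [Finset.mul_sum, Real.exp_sum, ← Finset.prod_mul_distrib, Fintype.sum_pow]
  exact squeeze_zero (fun n => Finset.sum_nonneg fun x _ => hprod n x) hchernoff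
    (tendsto_pow_atTop_nhds_zero_of_lt_one
      (Finset.sum_nonneg fun i _ => mul_nonneg (hp₀ i) (Real.exp_nonneg _)) hlt)

theorem tendsto_sum_prod_lt_of_entropy_lt (hp₀ : ∀ i, 0 ≤ p i) (hp : ∑ i, p i = 1) {a : ℝ}
    (ha : -∑ i, p i * Real.logb 2 (p i) < a) :
    Tendsto (fun n : ℕ => ∑ x : Fin n → ι with ∏ t, p (x t) < (2 : ℝ) ^ (-(n * a)),
      ∏ t, p (x t)) atTop (𝓝 0) := by
  have hmean : ∑ i, p i * (-Real.logb 2 (p i) - a) < 0 := by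
    simp only [mul_sub, mul_neg, Finset.sum_sub_distrib, Finset.sum_neg_distrib, ← Finset.sum_mul,
      hp]
    linarith
  refine tendsto_sum_prod_of_sum_mul_neg hp₀ hp hmean fun n x hne hx => ?_
  have hpos : 0 < ∏ t, p (x t) := (Finset.prod_nonneg fun t _ => hp₀ _).lt_of_ne' hne
  rw [← Real.logb_lt_iff_lt_rpow one_lt_two hpos,
    Real.logb_prod _ _ (Finset.prod_ne_zero_iff.1 hne)] at hx
  simp only [Finset.sum_sub_distrib, Finset.sum_neg_distrib, Finset.sum_const, Finset.card_univ,
    Fintype.card_fin, nsmul_eq_mul]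
  linarith

theorem tendsto_sum_lt_prod_of_lt_entropy (hp₀ : ∀ i, 0 ≤ p i) (hp : ∑ i, p i = 1) {a : ℝ}
    (ha : a < -∑ i, p i * Real.logb 2 (p i)) :
    Tendsto (fun n : ℕ => ∑ x : Fin n → ι with (2 : ℝ) ^ (-(n * a)) < ∏ t, p (x t),
      ∏ t, p (x t)) atTop (𝓝 0) := by
  have hmean : ∑ i, p i * (a + Real.logb 2 (p i)) < 0 := by
    simp only [mul_add, Finset.sum_add_distrib, ← Finset.sum_mul, hp]
    linarith
  refine tendsto_sum_prod_of_sum_mul_neg hp₀ hp hmean fun n x hne hx => ?_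
  have hpos : 0 < ∏ t, p (x t) := (Finset.prod_nonneg fun t _ => hp₀ _).lt_of_ne' hne
  rw [← Real.lt_logb_iff_rpow_lt one_lt_two hpos,
    Real.logb_prod _ _ (Finset.prod_ne_zero_iff.1 hne)] at hx
  simp only [Finset.sum_add_distrib, Finset.sum_const, Finset.card_univ, Fintype.card_fin,
    nsmul_eq_mul]
  linarith

theorem card_filter_rpow_neg_le_le_rpow (hp₀ : ∀ i, 0 ≤ p i)
    (hp : ∑ i, p i ≤ 1) (s : ℝ) :
    (Finset.card {i | (2 : ℝ) ^ (-s) ≤ p i} : ℝ) ≤ 2 ^ s := by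
  have hsum : (Finset.card {i | (2 : ℝ) ^ (-s) ≤ p i} : ℝ) * 2 ^ (-s) ≤ 1 := by
    rw [← nsmul_eq_mul]
    exact (Finset.card_nsmul_le_sum _ _ _ fun i hi => (Finset.mem_filter.1 hi).2).trans
      ((Finset.sum_le_univ_sum_of_nonneg hp₀).trans hp)
  rwa [← le_div_iff₀ (by positivity), one_div, ← Real.rpow_neg two_pos.le, neg_neg] at hsum

end TypicalSequences

section PositiveMatrices

open scoped MatrixOrder

variable {𝕜 a b κ ι : Type*} [RCLike 𝕜] [Fintype a]

theorem exists_conjTranspose_mul_self_of_nonneg {X : Matrix a a 𝕜} (hX : 0 ≤ X) :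
    ∃ B : Matrix a a 𝕜, X = Bᴴ * B := by
  classical
  exact CStarAlgebra.nonneg_iff_eq_star_mul_self.1 hX

theorem mul_mul_conjTranspose_mono [Finite b] {X Y : Matrix a a 𝕜} (h : X ≤ Y) (A : Matrix b a 𝕜) :
    A * X * Aᴴ ≤ A * Y * Aᴴ := by
  rw [Matrix.le_iff, ← Matrix.sub_mul, ← Matrix.mul_sub]
  exact (Matrix.le_iff.1 h).mul_mul_conjTranspose_same A

theorem mul_conjTranspose_le_one [Fintype b] [DecidableEq a] [DecidableEq b] {A : Matrix b a 𝕜}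
    (hA : Aᴴ * A ≤ 1) : A * Aᴴ ≤ 1 := by
  have hsq : A * Aᴴ * (A * Aᴴ) ≤ A * Aᴴ := by
    simpa [Matrix.mul_assoc] using mul_mul_conjTranspose_mono hA A
  have hdecomp : 1 - A * Aᴴ =
      (1 - A * Aᴴ) * (1 - A * Aᴴ)ᴴ + (A * Aᴴ - A * Aᴴ * (A * Aᴴ)) := by
    simp only [conjTranspose_sub, conjTranspose_one, conjTranspose_mul, conjTranspose_conjTranspose]
    noncomm_ring
  rw [← sub_nonneg, hdecomp]
  exact add_nonneg (posSemidef_self_mul_conjTranspose _).nonneg (sub_nonneg.2 hsq)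

theorem re_trace_mul_nonneg {X Y : Matrix a a 𝕜} (hX : 0 ≤ X) (hY : 0 ≤ Y) :
    0 ≤ RCLike.re (X * Y).trace := by
  obtain ⟨B, rfl⟩ := exists_conjTranspose_mul_self_of_nonneg hY
  rw [← Matrix.mul_assoc, trace_mul_cycle]
  exact (RCLike.nonneg_iff.1
    ((Matrix.nonneg_iff_posSemidef.1 hX).mul_mul_conjTranspose_same B).trace_nonneg).1

theorem re_trace_mul_le_re_trace [DecidableEq a] {X Y : Matrix a a 𝕜} (hX : 0 ≤ X) (hY : Y ≤ 1) :
    RCLike.re (X * Y).trace ≤ RCLike.re X.trace := by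
  simpa [Matrix.mul_sub] using re_trace_mul_nonneg hX (sub_nonneg.2 hY)

theorem le_one_of_trace_le_one [DecidableEq a] {X : Matrix a a 𝕜} (hX : 0 ≤ X)
    (htr : X.trace ≤ 1) : X ≤ 1 := by
  have hpsd := Matrix.nonneg_iff_posSemidef.1 hX
  have hsum : ∑ i, hpsd.isHermitian.eigenvalues i ≤ 1 := by
    rw [hpsd.isHermitian.trace_eq_sum_eigenvalues] at htr
    simpa using (RCLike.le_iff_re_im.1 htr).1
  rw [← map_one (algebraMap ℝ (Matrix a a 𝕜))]
  refine le_algebraMap_of_spectrum_le fun t ht => ?_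
  rw [hpsd.isHermitian.spectrum_real_eq_range_eigenvalues] at ht
  obtain ⟨i, rfl⟩ := ht
  exact (Finset.single_le_sum (fun j _ => hpsd.eigenvalues_nonneg j) (Finset.mem_univ i)).trans hsum

theorem exists_eq_mul_conjTranspose_isDiag {W : Matrix a a 𝕜} (hW : 0 ≤ W) :
    ∃ V : Matrix a a 𝕜, W = V * Vᴴ ∧ (Vᴴ * V).IsDiag := by
  classical
  have hpsd := Matrix.nonneg_iff_posSemidef.1 hW
  set U : Matrix a a 𝕜 := hpsd.isHermitian.eigenvectorUnitary.1
  set Λ : Matrix a a 𝕜 := diagonal fun i => (hpsd.isHermitian.eigenvalues i : 𝕜)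
  set S : Matrix a a 𝕜 := diagonal fun i => (√(hpsd.isHermitian.eigenvalues i) : 𝕜)
  have hU : Uᴴ * U = 1 := Unitary.coe_star_mul_self hpsd.isHermitian.eigenvectorUnitary
  have hspec : W = U * Λ * Uᴴ := hpsd.isHermitian.spectral_theorem
  have hSadj : Sᴴ = S := by
    simp only [S, diagonal_conjTranspose]
    congr 1
    ext i
    simp
  have hSsq : S * S = Λ := by
    simp only [S, Λ, diagonal_mul_diagonal, ← RCLike.ofReal_mul,
      Real.mul_self_sqrt (hpsd.eigenvalues_nonneg _)]
  refine ⟨U * S, ?_, ?_⟩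
  · rw [hspec, ← hSsq, conjTranspose_mul, hSadj]
    simp only [Matrix.mul_assoc]
  · rw [conjTranspose_mul, hSadj, Matrix.mul_assoc, ← Matrix.mul_assoc Uᴴ, hU, Matrix.one_mul, hSsq]
    exact isDiag_diagonal _

theorem sum_vecMulVec_star_eq_mul_conjTranspose [Fintype ι] (v : ι → κ → 𝕜) :
    ∑ i, vecMulVec (v i) (star (v i)) = (of v)ᵀ * (of v)ᵀᴴ := by
  ext p q
  simp [Matrix.sum_apply, mul_apply, vecMulVec_apply]

theorem sum_vecMulVec_star_le_one [Fintype ι] [DecidableEq a] {v : ι → a → 𝕜}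
    (horth : Pairwise fun i j => star (v i) ⬝ᵥ v j = 0) (hnorm : ∀ i, star (v i) ⬝ᵥ v i ≤ 1) :
    ∑ i, vecMulVec (v i) (star (v i)) ≤ 1 := by
  classical
  have hgram : (of v)ᵀᴴ * (of v)ᵀ = diagonal fun i => star (v i) ⬝ᵥ v i := by
    ext i j
    change star (v i) ⬝ᵥ v j = _
    rcases eq_or_ne i j with rfl | hij
    · rw [diagonal_apply_eq]
    · rw [diagonal_apply_ne _ hij, horth hij]
  rw [sum_vecMulVec_star_eq_mul_conjTranspose]
  refine mul_conjTranspose_le_one ?_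
  rw [hgram, Matrix.le_iff, ← diagonal_one, diagonal_sub, posSemidef_diagonal_iff]
  exact fun i => sub_nonneg.2 (hnorm i)

theorem exists_conjTranspose_mul_self_eq_sum_vecMulVec [Fintype b] {T : Finset ι}
    (hT : T.card ≤ Fintype.card b) (v : ι → κ → 𝕜) :
    ∃ A : Matrix b κ 𝕜, Aᴴ * A = ∑ i ∈ T, vecMulVec (v i) (star (v i)) := by
  classical
  obtain ⟨e⟩ : Nonempty (T ↪ b) := Function.Embedding.nonempty_of_card_le (by simpa using hT)
  let Φ : Matrix κ T 𝕜 := (of fun i : T => v i)ᵀ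
  let J : Matrix b T 𝕜 := (1 : Matrix b b 𝕜).submatrix id e
  have hJ : Jᴴ * J = 1 := by
    rw [conjTranspose_submatrix, conjTranspose_one, ← submatrix_mul _ _ _ _ _ Function.bijective_id,
      Matrix.one_mul, submatrix_one_embedding]
  refine ⟨J * Φᴴ, ?_⟩
  rw [conjTranspose_mul, conjTranspose_conjTranspose, Matrix.mul_assoc, ← Matrix.mul_assoc Jᴴ, hJ,
    Matrix.one_mul, ← sum_vecMulVec_star_eq_mul_conjTranspose,
    Finset.sum_coe_sort T fun i => vecMulVec (v i) (star (v i))]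

end PositiveMatrices

section NonzeroEigenvalues

open Polynomial

variable {R : Type*} [CommRing R] [IsDomain R]

theorem filter_ne_zero_roots_X_pow_mul [DecidableEq R] {P : R[X]} (hP : P ≠ 0) (n : ℕ) :
    (X ^ n * P).roots.filter (· ≠ 0) = P.roots.filter (· ≠ 0) := by
  rw [roots_mul (mul_ne_zero (pow_ne_zero n X_ne_zero) hP), roots_X_pow, Multiset.filter_add,
    Multiset.nsmul_singleton, Multiset.filter_eq_nil.2 fun z hz => by
      simp [Multiset.eq_of_mem_replicate hz], zero_add]

theorem filter_ne_zero_roots_charpoly_mul_comm [DecidableEq R] {m n : Type*} [Fintype m]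
    [Fintype n] [DecidableEq m] [DecidableEq n] (A : Matrix m n R) (B : Matrix n m R) :
    (A * B).charpoly.roots.filter (· ≠ 0) = (B * A).charpoly.roots.filter (· ≠ 0) := by
  rw [← filter_ne_zero_roots_X_pow_mul (charpoly_monic (A * B)).ne_zero (Fintype.card n),
    charpoly_mul_comm', filter_ne_zero_roots_X_pow_mul (charpoly_monic (B * A)).ne_zero]

theorem roots_charpoly_diagonal {n : Type*} [Fintype n] [DecidableEq n] (v : n → R) :
    (diagonal v).charpoly.roots = Finset.univ.val.map v := by
  rw [charpoly_diagonal, roots_prod _ _ (Finset.prod_ne_zero_iff.2 fun i _ => X_sub_C_ne_zero _)]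
  simp

theorem sum_map_filter_ne_zero {S : Type*} [AddCommMonoid S] {α : Type*} [Zero α] [DecidableEq α]
    (s : Multiset α) {f : α → S} (hf : f 0 = 0) :
    ((s.filter (· ≠ 0)).map f).sum = (s.map f).sum := by
  induction s using Multiset.induction with
  | empty => simp
  | cons z s ih => rcases eq_or_ne z 0 with rfl | hz <;> simp_all

end NonzeroEigenvalues

section CompletelyPositiveMaps

open scoped MatrixOrder

variable {a b ι : Type*} [Fintype a]

/-- The completely positive map `X ↦ ∑ i, K i X (K i)†` with Kraus operators `K i`, which may be
rectangular. -/
def krausMap [Fintype ι] (K : ι → Matrix b a ℂ) : Matrix a a ℂ →ₗ[ℂ] Matrix b b ℂ where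
  toFun X := ∑ i, K i * X * (K i)ᴴ
  map_add' X Y := by simp only [Matrix.mul_add, Matrix.add_mul, Finset.sum_add_distrib]
  map_smul' c X := by simp [Finset.smul_sum]

theorem krausMap_apply [Fintype ι] (K : ι → Matrix b a ℂ) (X : Matrix a a ℂ) :
    krausMap K X = ∑ i, K i * X * (K i)ᴴ := rfl

theorem krausMap_single_apply [Fintype ι] [DecidableEq a] (K : ι → Matrix b a ℂ) (j j' : a)
    (i i' : b) : krausMap K (single j j' 1) i i' = ∑ k, K k i j * star (K k i' j') := by
  rw [krausMap_apply, Matrix.sum_apply]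
  refine Finset.sum_congr rfl fun k _ => ?_
  simp [mul_apply, single_apply, ite_and]

theorem ampliation_krausMap [Fintype ι] {k : Type*} [Fintype k] [DecidableEq k]
    (K : ι → Matrix b a ℂ) (X : Matrix (a × k) (a × k) ℂ) :
    ampliation (krausMap K) X = krausMap (fun i => K i ⊗ₖ (1 : Matrix k k ℂ)) X := by
  ext p q
  simp only [ampliation, of_apply, krausMap_apply, Matrix.sum_apply]
  refine Finset.sum_congr rfl fun i _ => ?_
  simp only [mul_apply, conjTranspose_apply, kroneckerMap_apply, of_apply, one_apply,
    Fintype.sum_prod_type, Finset.sum_mul, mul_ite, mul_one, mul_zero, ite_mul, zero_mul,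
    star_zero, Finset.sum_ite_eq, Finset.mem_univ, if_true, apply_ite star]

theorem posSemidef_krausMap [Fintype ι] [Finite b] (K : ι → Matrix b a ℂ) {X : Matrix a a ℂ}
    (hX : X.PosSemidef) : (krausMap K X).PosSemidef :=
  posSemidef_sum _ fun i _ => hX.mul_mul_conjTranspose_same (K i)

theorem isCPTP_krausMap [Fintype ι] [Fintype b] [DecidableEq a] {K : ι → Matrix b a ℂ}
    (hK : ∑ i, (K i)ᴴ * K i = 1) : IsCPTP (krausMap K) where
  completely_positive k X hX := by
    rw [ampliation_krausMap]
    exact posSemidef_krausMap _ hX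
  trace_preserving X := by
    simp_rw [krausMap_apply, trace_sum, fun i => trace_mul_cycle (K i) X (K i)ᴴ]
    rw [← trace_sum, ← Finset.sum_mul, hK, one_mul]

variable [Fintype b] {Φ : Matrix a a ℂ →ₗ[ℂ] Matrix b b ℂ}

theorem IsCPTP.ampliation_posSemidef {k : Type*} [Finite k] (hΦ : IsCPTP Φ)
    {X : Matrix (a × k) (a × k) ℂ} (hX : X.PosSemidef) : (ampliation Φ X).PosSemidef := by
  obtain ⟨n, ⟨e⟩⟩ := Finite.exists_equiv_fin k
  have h := hΦ.completely_positive n _ (hX.submatrix (Prod.map id e.symm))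
  convert h.submatrix (Prod.map id e) using 1
  ext p q
  simp [ampliation]

theorem IsCPTP.map_nonneg (hΦ : IsCPTP Φ) {X : Matrix a a ℂ} (hX : 0 ≤ X) : 0 ≤ Φ X := by
  have h := hΦ.ampliation_posSemidef (k := Unit)
    ((Matrix.nonneg_iff_posSemidef.1 hX).submatrix Prod.fst)
  exact (h.submatrix fun i => (i, ())).nonneg

theorem IsCPTP.map_mono (hΦ : IsCPTP Φ) {X Y : Matrix a a ℂ} (h : X ≤ Y) : Φ X ≤ Φ Y := by
  rw [← sub_nonneg, ← map_sub]
  exact hΦ.map_nonneg (sub_nonneg.2 h)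

theorem exists_isCPTP_mul_mul_conjTranspose_le [DecidableEq a] [Nonempty b] {A : Matrix b a ℂ}
    (hA : Aᴴ * A ≤ 1) :
    ∃ Φ : Matrix a a ℂ →ₗ[ℂ] Matrix b b ℂ, IsCPTP Φ ∧ ∀ X, 0 ≤ X → A * X * Aᴴ ≤ Φ X := by
  classical
  obtain ⟨B, hB⟩ := exists_conjTranspose_mul_self_of_nonneg (sub_nonneg.2 hA)
  let o : b := Classical.arbitrary b
  -- If `A` fails, the basis state `o` is prepared.
  let K : Option a → Matrix b a ℂ := fun k => k.elim A fun k => single o k (1 : ℂ) * B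
  have hreset (k : a) : (single o k (1 : ℂ) * B)ᴴ * (single o k (1 : ℂ) * B) =
      Bᴴ * single k k (1 : ℂ) * B := by
    rw [conjTranspose_mul, conjTranspose_single, star_one, Matrix.mul_assoc,
      ← Matrix.mul_assoc (single k o _), single_mul_single_same, one_mul, Matrix.mul_assoc]
  refine ⟨krausMap K, isCPTP_krausMap ?_, fun X hX => ?_⟩
  · simp only [K, Fintype.sum_option, Option.elim_none, Option.elim_some, hreset,
      ← Finset.sum_mul, ← Finset.mul_sum, sum_single_one, Matrix.mul_one]
    rw [← hB, add_sub_cancel]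
  · rw [krausMap_apply, Fintype.sum_option]
    exact le_add_of_nonneg_right <| Finset.sum_nonneg fun k _ =>
      ((Matrix.nonneg_iff_posSemidef.1 hX).mul_mul_conjTranspose_same _).nonneg

end CompletelyPositiveMaps

section OneShotStorage

open scoped MatrixOrder

variable {a b ι : Type*} [Fintype a] [Fintype b] [Fintype ι]

theorem pureFidelity_nonneg {v : a → ℂ} {X : Matrix a a ℂ} (hX : 0 ≤ X) : 0 ≤ pureFidelity v X :=
  (Matrix.nonneg_iff_posSemidef.1 hX).re_dotProduct_nonneg v

theorem pureFidelity_mono (v : a → ℂ) {X Y : Matrix a a ℂ} (h : X ≤ Y) :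
    pureFidelity v X ≤ pureFidelity v Y := by
  simpa [pureFidelity, sub_mulVec, dotProduct_sub] using
    pureFidelity_nonneg (v := v) (sub_nonneg.2 h)

theorem pureFidelity_eq_trace (v : a → ℂ) (X : Matrix a a ℂ) :
    pureFidelity v X = (X * vecMulVec v (star v)).trace.re := by
  rw [mul_vecMulVec, trace_vecMulVec, dotProduct_comm, pureFidelity]

theorem sum_pureFidelity (v : ι → a → ℂ) (X : Matrix a a ℂ) :
    ∑ i, pureFidelity (v i) X = (X * ∑ i, vecMulVec (v i) (star (v i))).trace.re := by
  simp only [pureFidelity_eq_trace, Finset.mul_sum, trace_sum, Complex.re_sum]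

theorem sq_pureFidelity_le (v : a → ℂ) (X : Matrix a a ℂ) :
    pureFidelity v X ^ 2 ≤ pureFidelity v (X * vecMulVec v (star v) * Xᴴ) := by
  have hnormSq : star v ⬝ᵥ ((X * vecMulVec v (star v) * Xᴴ) *ᵥ v) =
      (Complex.normSq (star v ⬝ᵥ (X *ᵥ v)) : ℂ) := by
    have hstar : star v ⬝ᵥ (Xᴴ *ᵥ v) = star (star v ⬝ᵥ (X *ᵥ v)) := by
      rw [star_dotProduct, star_mulVec, conjTranspose_conjTranspose, dotProduct_mulVec]
    rw [← mulVec_mulVec, ← mulVec_mulVec, vecMulVec_mulVec, mulVec_smul, dotProduct_smul, hstar]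
    exact Complex.mul_conj _
  rw [pureFidelity, pureFidelity, hnormSq, Complex.ofReal_re, sq, Complex.normSq_apply]
  exact le_add_of_nonneg_right (mul_self_nonneg _)

theorem exists_isCPTP_sq_pureFidelity_le [DecidableEq a] [Nonempty a] [Nonempty b]
    {A : Matrix b a ℂ} (hA : Aᴴ * A ≤ 1) :
    ∃ (C : Matrix a a ℂ →ₗ[ℂ] Matrix b b ℂ) (D : Matrix b b ℂ →ₗ[ℂ] Matrix a a ℂ),
      IsCPTP C ∧ IsCPTP D ∧ ∀ v : a → ℂ,
        pureFidelity v (Aᴴ * A) ^ 2 ≤ pureFidelity v (D (C (vecMulVec v (star v)))) := by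
  classical
  obtain ⟨C, hC, hAC⟩ := exists_isCPTP_mul_mul_conjTranspose_le hA
  obtain ⟨D, hD, hAD⟩ := exists_isCPTP_mul_mul_conjTranspose_le (A := Aᴴ)
    (by simpa using mul_conjTranspose_le_one hA)
  refine ⟨C, D, hC, hD, fun v => ?_⟩
  have hv : 0 ≤ vecMulVec v (star v) := (posSemidef_vecMulVec_self_star v).nonneg
  calc pureFidelity v (Aᴴ * A) ^ 2
      ≤ pureFidelity v (Aᴴ * A * vecMulVec v (star v) * (Aᴴ * A)ᴴ) := sq_pureFidelity_le _ _
    _ = pureFidelity v (Aᴴ * (A * vecMulVec v (star v) * Aᴴ) * Aᴴᴴ) := by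
        simp only [conjTranspose_mul, conjTranspose_conjTranspose, Matrix.mul_assoc]
    _ ≤ pureFidelity v (Aᴴ * C (vecMulVec v (star v)) * Aᴴᴴ) :=
        pureFidelity_mono v (mul_mul_conjTranspose_mono (hAC _ hv) _)
    _ ≤ pureFidelity v (D (C (vecMulVec v (star v)))) :=
        pureFidelity_mono v (hAD _ (hC.map_nonneg hv))

theorem sum_pureFidelity_le_re_trace [DecidableEq a] {v : ι → a → ℂ}
    (hv : ∑ i, vecMulVec (v i) (star (v i)) ≤ 1) {X : Matrix a a ℂ} (hX : 0 ≤ X) :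
    ∑ i, pureFidelity (v i) X ≤ X.trace.re :=
  (sum_pureFidelity v X).trans_le (re_trace_mul_le_re_trace hX hv)

theorem pureFidelity_le_one [DecidableEq a] {v : ι → a → ℂ}
    (hv : ∑ i, vecMulVec (v i) (star (v i)) ≤ 1) {X : Matrix a a ℂ} (hX : 0 ≤ X)
    (htr : X.trace ≤ 1) (i : ι) : pureFidelity (v i) X ≤ 1 :=
  calc pureFidelity (v i) X ≤ ∑ j, pureFidelity (v j) X :=
        Finset.single_le_sum (f := fun j => pureFidelity (v j) X)
          (fun _ _ => pureFidelity_nonneg hX) (Finset.mem_univ i)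
    _ ≤ X.trace.re := sum_pureFidelity_le_re_trace hv hX
    _ ≤ 1 := (Complex.le_def.1 htr).1

theorem sum_mul_pureFidelity_le [DecidableEq a] {v : ι → a → ℂ}
    (hv : ∑ i, vecMulVec (v i) (star (v i)) ≤ 1) {p : ι → ℝ} (hp : ∀ i, 0 ≤ p i)
    {τ : ι → Matrix b b ℂ} (hτ : ∀ i, 0 ≤ τ i) (hτtr : ∀ i, (τ i).trace ≤ 1)
    {D : Matrix b b ℂ →ₗ[ℂ] Matrix a a ℂ} (hD : IsCPTP D) {c : ℝ} (hc : 0 ≤ c) :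
    ∑ i, p i * pureFidelity (v i) (D (τ i)) ≤ ∑ i with c < p i, p i + c * Fintype.card b := by
  classical
  have hDone : 0 ≤ D 1 := hD.map_nonneg zero_le_one
  have hlarge (i : ι) : p i * pureFidelity (v i) (D (τ i)) ≤ p i :=
    mul_le_of_le_one_right (hp i) <| pureFidelity_le_one hv (hD.map_nonneg (hτ i))
      ((hD.trace_preserving (τ i)).trans_le (hτtr i)) i
  have hsmall (i : ι) (hi : p i ≤ c) :
      p i * pureFidelity (v i) (D (τ i)) ≤ c * pureFidelity (v i) (D 1) :=
    mul_le_mul hi (pureFidelity_mono _ (hD.map_mono (le_one_of_trace_le_one (hτ i) (hτtr i))))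
      (pureFidelity_nonneg (hD.map_nonneg (hτ i))) hc
  have hdim : ∑ i, pureFidelity (v i) (D 1) ≤ Fintype.card b := by
    simpa [hD.trace_preserving] using sum_pureFidelity_le_re_trace hv hDone
  calc ∑ i, p i * pureFidelity (v i) (D (τ i))
      = ∑ i with c < p i, p i * pureFidelity (v i) (D (τ i)) +
          ∑ i with ¬ c < p i, p i * pureFidelity (v i) (D (τ i)) :=
        (Finset.sum_filter_add_sum_filter_not _ _ _).symm
    _ ≤ ∑ i with c < p i, p i + ∑ i with ¬ c < p i, c * pureFidelity (v i) (D 1) :=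
        add_le_add (Finset.sum_le_sum fun i _ => hlarge i) <| Finset.sum_le_sum fun i hi =>
          hsmall i (not_lt.1 (Finset.mem_filter.1 hi).2)
    _ ≤ ∑ i with c < p i, p i + c * ∑ i, pureFidelity (v i) (D 1) := by
        rw [Finset.mul_sum]
        exact add_le_add_right (Finset.sum_le_univ_sum_of_nonneg fun i =>
          mul_nonneg hc (pureFidelity_nonneg hDone)) _
    _ ≤ ∑ i with c < p i, p i + c * Fintype.card b :=
        add_le_add_right (mul_le_mul_of_nonneg_left hdim hc) _

end OneShotStorage

section KrausVectors

variable {d : Type*} [Fintype d] [DecidableEq d]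

theorem krausVec_apply (M : Matrix d d ℂ) (p : d × d) :
    krausVec M p = M p.1 p.2 * ((√(Fintype.card d : ℝ))⁻¹ : ℝ) := by
  simp [krausVec, maxEntangled, mulVec, dotProduct, one_apply, Fintype.sum_prod_type]

theorem ofReal_inv_sqrt_card_mul_self (d : Type*) [Fintype d] :
    (((√(Fintype.card d : ℝ))⁻¹ : ℝ) : ℂ) * ((√(Fintype.card d : ℝ))⁻¹ : ℝ) =
      (Fintype.card d : ℂ)⁻¹ := by
  rw [← Complex.ofReal_mul, ← mul_inv, Real.mul_self_sqrt (Nat.cast_nonneg _), Complex.ofReal_inv,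
    Complex.ofReal_natCast]

theorem star_krausVec_dotProduct (A B : Matrix d d ℂ) :
    star (krausVec A) ⬝ᵥ krausVec B = (Aᴴ * B).trace * (Fintype.card d : ℂ)⁻¹ := by
  rw [← ofReal_inv_sqrt_card_mul_self, trace]
  simp only [dotProduct, Pi.star_apply, krausVec_apply, diag_apply, mul_apply,
    conjTranspose_apply, Fintype.sum_prod_type_right, Finset.sum_mul, star_mul', RCLike.star_def,
    Complex.conj_ofReal]
  exact Finset.sum_congr rfl fun i _ => Finset.sum_congr rfl fun j _ => by ring

theorem vecMulVec_krausVec_apply (A B : Matrix d d ℂ) (p q : d × d) :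
    vecMulVec (krausVec A) (star (krausVec B)) p q =
      A p.1 p.2 * star (B q.1 q.2) * (Fintype.card d : ℂ)⁻¹ := by
  rw [← ofReal_inv_sqrt_card_mul_self, vecMulVec_apply, Pi.star_apply, krausVec_apply,
    krausVec_apply, star_mul', RCLike.star_def, Complex.conj_ofReal]
  ring

theorem krausVec_surjective [Nonempty d] :
    Function.Surjective (krausVec : Matrix d d ℂ → d × d → ℂ) := fun w => by
  refine ⟨of fun i j => w (i, j) * (√(Fintype.card d : ℝ) : ℝ), funext fun p => ?_⟩
  have hcard : √(Fintype.card d : ℝ) ≠ 0 := by positivity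
  rw [krausVec_apply, of_apply, mul_assoc, ← Complex.ofReal_mul, mul_inv_cancel₀ hcard,
    Complex.ofReal_one, mul_one]

theorem krausWeight_nonneg (M : Matrix d d ℂ) : 0 ≤ krausWeight M :=
  Finset.sum_nonneg fun _ _ => sq_nonneg _

theorem ofReal_krausWeight (M : Matrix d d ℂ) :
    (krausWeight M : ℂ) = star (krausVec M) ⬝ᵥ krausVec M := by
  rw [krausWeight, Complex.ofReal_sum]
  refine Finset.sum_congr rfl fun p _ => ?_
  rw [Pi.star_apply, RCLike.star_def, Complex.conj_mul', Complex.ofReal_pow]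

theorem ofReal_krausWeight_eq_trace (M : Matrix d d ℂ) :
    (krausWeight M : ℂ) = (Mᴴ * M).trace * (Fintype.card d : ℂ)⁻¹ := by
  rw [ofReal_krausWeight, star_krausVec_dotProduct]

theorem krausVec_eq_smul_krausState (M : Matrix d d ℂ) :
    krausVec M = √(krausWeight M) • krausState M := by
  rcases (krausWeight_nonneg M).eq_or_lt with h | h
  · have hzero : krausVec M = 0 := by
      rw [← dotProduct_star_self_eq_zero, ← ofReal_krausWeight, ← h, Complex.ofReal_zero]
    rw [krausState, hzero, smul_zero, smul_zero]
  · rw [krausState, smul_smul, mul_inv_cancel₀ (Real.sqrt_pos.2 h).ne', one_smul]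

theorem krausWeight_smul_vecMulVec_krausState (M : Matrix d d ℂ) :
    (krausWeight M : ℂ) • vecMulVec (krausState M) (star (krausState M)) =
      vecMulVec (krausVec M) (star (krausVec M)) := by
  rw [krausVec_eq_smul_krausState, star_smul, smul_vecMulVec, vecMulVec_smul, smul_smul,
    star_trivial √(krausWeight M), Real.mul_self_sqrt (krausWeight_nonneg M), Complex.coe_smul]

theorem krausWeight_mul_pureFidelity_krausState (M : Matrix d d ℂ) (X : Matrix (d × d) (d × d) ℂ) :
    krausWeight M * pureFidelity (krausState M) X = pureFidelity (krausVec M) X := by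
  rw [pureFidelity_eq_trace, pureFidelity_eq_trace, ← krausWeight_smul_vecMulVec_krausState,
    Matrix.mul_smul, trace_smul, smul_eq_mul, Complex.re_ofReal_mul]

theorem star_krausState_dotProduct (A B : Matrix d d ℂ) :
    star (krausState A) ⬝ᵥ krausState B =
      (((√(krausWeight A))⁻¹ * (√(krausWeight B))⁻¹ : ℝ) : ℂ) *
        (star (krausVec A) ⬝ᵥ krausVec B) := by
  simp only [krausState, star_smul, smul_dotProduct, dotProduct_smul, Complex.real_smul,
    star_trivial (√(krausWeight A))⁻¹, Complex.ofReal_mul]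
  ring

theorem star_krausState_dotProduct_eq_zero {A B : Matrix d d ℂ} (h : (Aᴴ * B).trace = 0) :
    star (krausState A) ⬝ᵥ krausState B = 0 := by
  rw [star_krausState_dotProduct, star_krausVec_dotProduct, h, zero_mul, mul_zero]

theorem star_krausState_dotProduct_self (M : Matrix d d ℂ) :
    star (krausState M) ⬝ᵥ krausState M = if krausWeight M = 0 then 0 else 1 := by
  rw [star_krausState_dotProduct, ← ofReal_krausWeight, ← Complex.ofReal_mul, ← mul_inv,
    Real.mul_self_sqrt (krausWeight_nonneg M)]
  split_ifs with h
  · simp [h]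
  · rw [inv_mul_cancel₀ h, Complex.ofReal_one]

theorem star_krausState_dotProduct_self_le_one (M : Matrix d d ℂ) :
    star (krausState M) ⬝ᵥ krausState M ≤ 1 := by
  rw [star_krausState_dotProduct_self]
  split_ifs
  exacts [zero_le_one, le_rfl]

end KrausVectors

section ChoiState

variable {d ι : Type*} [Fintype d] [DecidableEq d] [Fintype ι] {E : Matrix d d ℂ →ₗ[ℂ] Matrix d d ℂ}
  {M : ι → Matrix d d ℂ}

theorem choiState_apply (E : Matrix d d ℂ →ₗ[ℂ] Matrix d d ℂ) (p q : d × d) :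
    choiState E p q = E (single p.2 q.2 1) p.1 q.1 * (Fintype.card d : ℂ)⁻¹ := by
  have hblock : (of fun i j =>
      vecMulVec (maxEntangled d) (star (maxEntangled d)) (i, p.2) (j, q.2)) =
        (Fintype.card d : ℂ)⁻¹ • (single p.2 q.2 1 : Matrix d d ℂ) := by
    ext i j
    rw [← ofReal_inv_sqrt_card_mul_self]
    simp only [of_apply, vecMulVec_apply, maxEntangled, Pi.star_apply, Matrix.smul_apply,
      single_apply, smul_eq_mul]
    by_cases h1 : p.2 = i <;> by_cases h2 : q.2 = j <;>
      simp [h1, h2, eq_comm (a := i), eq_comm (a := j)]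
  rw [choiState, ampliation, of_apply, hblock, map_smul, Matrix.smul_apply, smul_eq_mul, mul_comm]

theorem IsCPTP.posSemidef_choiState (hE : IsCPTP E) : (choiState E).PosSemidef :=
  hE.ampliation_posSemidef (posSemidef_vecMulVec_self_star _)

theorem isKraus_iff_map_single : IsKraus E M ↔
    ∀ j j' i i', E (single j j' 1) i i' = ∑ k, M k i j * star (M k i' j') := by
  have hmap : IsKraus E M ↔ E = krausMap M :=
    ⟨fun h => LinearMap.ext h, fun h ρ => by rw [h, krausMap_apply]⟩
  rw [hmap]
  refine ⟨fun h j j' i i' => by rw [h, krausMap_single_apply], fun h => ?_⟩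
  refine Matrix.ext_linearMap _ fun j j' => LinearMap.ext_ring ?_
  ext i i'
  simpa [krausMap_single_apply] using h j j' i i'

theorem isKraus_iff_choiState_eq [Nonempty d] : IsKraus E M ↔
    choiState E = ∑ k, vecMulVec (krausVec (M k)) (star (krausVec (M k))) := by
  have hcard : (Fintype.card d : ℂ)⁻¹ ≠ 0 := by simp
  simp only [isKraus_iff_map_single, ← Matrix.ext_iff, Prod.forall, choiState_apply,
    Matrix.sum_apply, vecMulVec_krausVec_apply, ← Finset.sum_mul, mul_left_inj' hcard]
  exact ⟨fun h i j i' j' => h j j' i i', fun h j j' i i' => h i j i' j'⟩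

variable [Nonempty d]

theorem IsKraus.sum_krausWeight (hM : IsKraus E M) (hE : ∀ X, (E X).trace = X.trace) :
    ∑ k, krausWeight (M k) = 1 := by
  have htrace : ∑ k, ((M k)ᴴ * M k).trace = Fintype.card d := by
    rw [← trace_one, ← hE 1, hM, trace_sum]
    exact Finset.sum_congr rfl fun k _ => by rw [mul_one, trace_mul_comm]
  have hcard : (Fintype.card d : ℂ) ≠ 0 := by simp
  rw [← Complex.ofReal_inj, Complex.ofReal_sum, Complex.ofReal_one]
  simp only [ofReal_krausWeight_eq_trace]
  rw [← Finset.sum_mul, htrace, mul_inv_cancel₀ hcard]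

theorem IsKraus.sum_krausWeight_mul_pureFidelity (hM : IsKraus E M)
    (X : Matrix (d × d) (d × d) ℂ) :
    ∑ k, krausWeight (M k) * pureFidelity (krausState (M k)) X = (X * choiState E).trace.re := by
  simp only [krausWeight_mul_pureFidelity_krausState, sum_pureFidelity,
    ← isKraus_iff_choiState_eq.1 hM]

theorem IsKraus.krausWeight_le_one (hM : IsKraus E M) (hE : ∀ X, (E X).trace = X.trace) (k : ι) :
    krausWeight (M k) ≤ 1 := by
  rw [← hM.sum_krausWeight hE]
  exact Finset.single_le_sum (fun j _ => krausWeight_nonneg (M j)) (Finset.mem_univ k)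

end ChoiState

section DiagonalRepresentations

open scoped MatrixOrder

variable {d ι : Type*} [Fintype d] [DecidableEq d] [Fintype ι] {E : Matrix d d ℂ →ₗ[ℂ] Matrix d d ℂ}
  {M : ι → Matrix d d ℂ}

theorem exists_isDiagonalKraus [Nonempty d] (hE : (choiState E).PosSemidef) :
    ∃ (r : ℕ) (M : Fin r → Matrix d d ℂ), IsDiagonalKraus E M := by
  obtain ⟨V, hV, hdiag⟩ := exists_eq_mul_conjTranspose_isDiag hE.nonneg
  choose M hM using fun k => krausVec_surjective (Vᵀ k)
  let e := (Fintype.equivFin (d × d)).symm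
  refine ⟨_, fun k => M (e k), isKraus_iff_choiState_eq.2 ?_, fun k l hkl => ?_⟩
  · rw [e.sum_comp fun k => vecMulVec (krausVec (M k)) (star (krausVec (M k))), hV]
    simp only [hM]
    exact (sum_vecMulVec_star_eq_mul_conjTranspose Vᵀ).symm
  · have horth : star (krausVec (M (e k))) ⬝ᵥ krausVec (M (e l)) = 0 := by
      rw [hM, hM]
      exact hdiag (e.injective.ne hkl)
    simpa [star_krausVec_dotProduct] using horth

theorem IsDiagonalKraus.filter_roots_charpoly [Nonempty d] (hM : IsDiagonalKraus E M) :
    (choiState E).charpoly.roots.filter (· ≠ 0) =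
      (Finset.univ.val.map fun μ => (krausWeight (M μ) : ℂ)).filter (· ≠ 0) := by
  classical
  let V : Matrix (d × d) ι ℂ := (of fun μ => krausVec (M μ))ᵀ
  have hchoi : choiState E = V * Vᴴ := by
    rw [isKraus_iff_choiState_eq.1 hM.isKraus, sum_vecMulVec_star_eq_mul_conjTranspose]
  have hgram : Vᴴ * V = diagonal fun μ => (krausWeight (M μ) : ℂ) := by
    ext μ ν
    change star (krausVec (M μ)) ⬝ᵥ krausVec (M ν) = _
    rcases eq_or_ne μ ν with rfl | hμν
    · rw [diagonal_apply_eq, ofReal_krausWeight]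
    · rw [diagonal_apply_ne _ hμν, star_krausVec_dotProduct, hM.trace_orthogonal μ ν hμν, zero_mul]
  rw [hchoi, filter_ne_zero_roots_charpoly_mul_comm, hgram, roots_charpoly_diagonal]

theorem IsDiagonalKraus.mapEntropy_eq [Nonempty d] (hM : IsDiagonalKraus E M) :
    mapEntropy E = -∑ μ, krausWeight (M μ) * Real.logb 2 (krausWeight (M μ)) := by
  rw [mapEntropy, ← sum_map_filter_ne_zero _ (by simp), hM.filter_roots_charpoly,
    sum_map_filter_ne_zero _ (by simp), Multiset.map_map]
  rfl

theorem IsCPTP.mapEntropy_nonneg [Nonempty d] (hE : IsCPTP E) : 0 ≤ mapEntropy E := by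
  obtain ⟨r, M, hM⟩ := exists_isDiagonalKraus hE.posSemidef_choiState
  rw [hM.mapEntropy_eq, neg_nonneg]
  exact Finset.sum_nonpos fun μ _ => mul_nonpos_of_nonneg_of_nonpos (krausWeight_nonneg _)
    (Real.logb_nonpos one_lt_two (krausWeight_nonneg _)
      (hM.isKraus.krausWeight_le_one hE.trace_preserving μ))

end DiagonalRepresentations

section DiagonalCoding

open scoped MatrixOrder

variable {d ι : Type*} [Fintype d] [DecidableEq d] [Fintype ι] {M : ι → Matrix d d ℂ}

theorem sum_vecMulVec_krausState_le_one (hM : Pairwise fun x y => ((M x)ᴴ * M y).trace = 0) :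
    ∑ x, vecMulVec (krausState (M x)) (star (krausState (M x))) ≤ 1 :=
  sum_vecMulVec_star_le_one (fun _ _ hxy => star_krausState_dotProduct_eq_zero (hM hxy))
    fun x => star_krausState_dotProduct_self_le_one (M x)

theorem krausWeight_mul_pureFidelity_krausState_self (M : Matrix d d ℂ) :
    krausWeight M * pureFidelity (krausState M) (vecMulVec (krausState M) (star (krausState M))) =
      krausWeight M := by
  rw [pureFidelity, vecMulVec_mulVec, dotProduct_smul, star_krausState_dotProduct_self]
  split_ifs with h <;> simp [h]

theorem sum_krausWeight_le_sum_mul_pureFidelity (M : ι → Matrix d d ℂ) (T : Finset ι) :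
    ∑ x ∈ T, krausWeight (M x) ≤ ∑ x, krausWeight (M x) * pureFidelity (krausState (M x))
      (∑ y ∈ T, vecMulVec (krausState (M y)) (star (krausState (M y)))) := by
  have hnonneg (y : ι) : 0 ≤ vecMulVec (krausState (M y)) (star (krausState (M y))) :=
    (posSemidef_vecMulVec_self_star _).nonneg
  calc ∑ x ∈ T, krausWeight (M x)
      = ∑ x ∈ T, krausWeight (M x) * pureFidelity (krausState (M x))
          (vecMulVec (krausState (M x)) (star (krausState (M x)))) := by
        simp only [krausWeight_mul_pureFidelity_krausState_self]
    _ ≤ ∑ x ∈ T, krausWeight (M x) * pureFidelity (krausState (M x))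
          (∑ y ∈ T, vecMulVec (krausState (M y)) (star (krausState (M y)))) :=
        Finset.sum_le_sum fun x hx => mul_le_mul_of_nonneg_left
          (pureFidelity_mono _ (Finset.single_le_sum (fun y _ => hnonneg y) hx))
          (krausWeight_nonneg _)
    _ ≤ _ := Finset.sum_le_univ_sum_of_nonneg fun x => mul_nonneg (krausWeight_nonneg _)
        (pureFidelity_nonneg (Finset.sum_nonneg fun y _ => hnonneg y))

theorem IsDiagonalKraus.exists_isCPTP_two_mul_sum_sub_one_le [Nonempty d] {b : Type*} [Fintype b]
    [Nonempty b] {E : Matrix d d ℂ →ₗ[ℂ] Matrix d d ℂ} (hM : IsDiagonalKraus E M)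
    (hE : ∀ X, (E X).trace = X.trace) {T : Finset ι} (hT : T.card ≤ Fintype.card b) :
    ∃ (C : Matrix (d × d) (d × d) ℂ →ₗ[ℂ] Matrix b b ℂ)
      (D : Matrix b b ℂ →ₗ[ℂ] Matrix (d × d) (d × d) ℂ), IsCPTP C ∧ IsCPTP D ∧
        ∀ (κ : Type*) [Fintype κ] (N : κ → Matrix d d ℂ), IsKraus E N →
          2 * ∑ x ∈ T, krausWeight (M x) - 1 ≤ ∑ k, krausWeight (N k) *
            pureFidelity (krausState (N k))
              (D (C (vecMulVec (krausState (N k)) (star (krausState (N k)))))) := by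
  obtain ⟨A, hA⟩ := exists_conjTranspose_mul_self_eq_sum_vecMulVec hT fun x => krausState (M x)
  have hA_le : Aᴴ * A ≤ 1 := by
    rw [hA]
    exact (Finset.sum_le_univ_sum_of_nonneg fun x =>
      (posSemidef_vecMulVec_self_star _).nonneg).trans
        (sum_vecMulVec_krausState_le_one fun x y => hM.trace_orthogonal x y)
  obtain ⟨C, D, hC, hD, hCD⟩ := exists_isCPTP_sq_pureFidelity_le hA_le
  refine ⟨C, D, hC, hD, fun κ _ N hN => ?_⟩
  have htransfer : ∑ x ∈ T, krausWeight (M x) ≤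
      ∑ k, krausWeight (N k) * pureFidelity (krausState (N k)) (Aᴴ * A) := by
    rw [hN.sum_krausWeight_mul_pureFidelity, ← hM.isKraus.sum_krausWeight_mul_pureFidelity, hA]
    exact sum_krausWeight_le_sum_mul_pureFidelity M T
  have hpoint (v : d × d → ℂ) : 2 * pureFidelity v (Aᴴ * A) - 1 ≤
      pureFidelity v (D (C (vecMulVec v (star v)))) := by
    linarith [hCD v, sq_nonneg (pureFidelity v (Aᴴ * A) - 1)]
  calc 2 * ∑ x ∈ T, krausWeight (M x) - 1
      ≤ 2 * ∑ k, krausWeight (N k) * pureFidelity (krausState (N k)) (Aᴴ * A) - 1 := by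
        linarith
    _ = ∑ k, krausWeight (N k) * (2 * pureFidelity (krausState (N k)) (Aᴴ * A) - 1) := by
        simp only [mul_sub, mul_one, mul_left_comm _ (2 : ℝ), Finset.sum_sub_distrib,
          ← Finset.mul_sum, hN.sum_krausWeight hE]
    _ ≤ _ := Finset.sum_le_sum fun k _ =>
        mul_le_mul_of_nonneg_left (hpoint _) (krausWeight_nonneg _)

end DiagonalCoding

section TensorPowers

variable {d : Type*} [Fintype d] {n : ℕ}

theorem trace_conjTranspose_tensorOp_mul (A B : Fin n → Matrix d d ℂ) :
    ((tensorOp A)ᴴ * tensorOp B).trace = ∏ t, ((A t)ᴴ * B t).trace := by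
  simp only [trace, diag_apply, mul_apply, conjTranspose_apply, tensorOp, of_apply, star_prod,
    ← Finset.prod_mul_distrib, Fintype.prod_sum]

variable [DecidableEq d]

/-- The tensor product `E 0 ⊗ ⋯ ⊗ E (n-1)` of maps on a matrix algebra, acting on the operators on
`n` copies of the system. It is given by its values on the matrix units of the tensor product. -/
def tensorMap (E : Fin n → Matrix d d ℂ →ₗ[ℂ] Matrix d d ℂ) :
    Matrix (Fin n → d) (Fin n → d) ℂ →ₗ[ℂ] Matrix (Fin n → d) (Fin n → d) ℂ where
  toFun X := of fun i i' => ∑ j, ∑ j', X j j' * ∏ t, E t (single (j t) (j' t) 1) (i t) (i' t)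
  map_add' X Y := by
    ext
    simp only [of_apply, Matrix.add_apply, add_mul, Finset.sum_add_distrib]
  map_smul' c X := by
    ext
    simp only [of_apply, Matrix.smul_apply, smul_eq_mul, mul_assoc, Finset.mul_sum,
      RingHom.id_apply]

theorem tensorMap_apply (E : Fin n → Matrix d d ℂ →ₗ[ℂ] Matrix d d ℂ)
    (X : Matrix (Fin n → d) (Fin n → d) ℂ) (i i' : Fin n → d) : tensorMap E X i i' =
      ∑ j, ∑ j', X j j' * ∏ t, E t (single (j t) (j' t) 1) (i t) (i' t) := rfl

theorem tensorMap_single_apply (E : Fin n → Matrix d d ℂ →ₗ[ℂ] Matrix d d ℂ)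
    (j j' i i' : Fin n → d) :
    tensorMap E (single j j' 1) i i' = ∏ t, E t (single (j t) (j' t) 1) (i t) (i' t) := by
  simp [tensorMap_apply, single_apply, ite_and]

theorem trace_single_one {a R : Type*} [Fintype a] [DecidableEq a] [AddCommMonoidWithOne R]
    (j j' : a) : (single j j' (1 : R)).trace = if j = j' then 1 else 0 := by
  split_ifs with h
  · rw [h, trace_single_eq_same]
  · exact trace_single_eq_of_ne _ _ _ h

theorem trace_tensorMap {E : Fin n → Matrix d d ℂ →ₗ[ℂ] Matrix d d ℂ}
    (hE : ∀ t X, (E t X).trace = X.trace) (X : Matrix (Fin n → d) (Fin n → d) ℂ) :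
    (tensorMap E X).trace = X.trace := by
  suffices traceLinearMap _ ℂ ℂ ∘ₗ tensorMap E = traceLinearMap _ ℂ ℂ from
    LinearMap.congr_fun this X
  refine Matrix.ext_linearMap _ fun j j' => LinearMap.ext_ring ?_
  calc (tensorMap E (single j j' 1)).trace
      = ∏ t, (E t (single (j t) (j' t) 1)).trace := by
        simp only [trace, diag_apply, tensorMap_single_apply, Fintype.prod_sum]
    _ = (single j j' (1 : ℂ)).trace := by
        simp only [hE, trace_single_one, Finset.prod_boole, Finset.mem_univ, true_imp_iff,
          funext_iff]

theorem isKraus_tensorMap {E : Fin n → Matrix d d ℂ →ₗ[ℂ] Matrix d d ℂ} {ι : Fin n → Type*}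
    [∀ t, Fintype (ι t)] {M : ∀ t, ι t → Matrix d d ℂ} (hM : ∀ t, IsKraus (E t) (M t)) :
    IsKraus (tensorMap E) fun x : ∀ t, ι t => tensorOp fun t => M t (x t) := by
  refine isKraus_iff_map_single.2 fun j j' i i' => ?_
  simp only [tensorMap_single_apply, isKraus_iff_map_single.1 (hM _), Fintype.prod_sum,
    tensorOp, of_apply, star_prod, Finset.prod_mul_distrib]

theorem krausWeight_tensorOp (A : Fin n → Matrix d d ℂ) :
    krausWeight (tensorOp A) = ∏ t, krausWeight (A t) := by
  rw [← Complex.ofReal_inj, Complex.ofReal_prod]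
  simp only [ofReal_krausWeight_eq_trace, trace_conjTranspose_tensorOp_mul,
    Finset.prod_mul_distrib, Fintype.card_fun, Fintype.card_fin, Finset.prod_const,
    Finset.card_univ, Nat.cast_pow, inv_pow]

theorem IsDiagonalKraus.tensorMap_tensorOp {E : Matrix d d ℂ →ₗ[ℂ] Matrix d d ℂ} {ι : Type*}
    [Fintype ι] {M : ι → Matrix d d ℂ} (hM : IsDiagonalKraus E M) (n : ℕ) :
    IsDiagonalKraus (tensorMap fun _ : Fin n => E)
      fun x : Fin n → ι => tensorOp fun t => M (x t) where
  isKraus := isKraus_tensorMap fun _ => hM.isKraus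
  trace_orthogonal x y hxy := by
    obtain ⟨t, ht⟩ := Function.ne_iff.1 hxy
    rw [trace_conjTranspose_tensorOp_mul]
    exact Finset.prod_eq_zero (Finset.mem_univ t) (hM.trace_orthogonal _ _ ht)

end TensorPowers

section Rates

open scoped MatrixOrder Topology

variable {d : Type*} [Fintype d] [DecidableEq d] [Nonempty d]
  {E : Matrix d d ℂ →ₗ[ℂ] Matrix d d ℂ} {R : ℝ}

theorem IsDiagonalKraus.eventually_sum_mul_pureFidelity_le {ι : Type*} [Fintype ι]
    {M : ι → Matrix d d ℂ} (hM : IsDiagonalKraus E M) (hE : ∀ X, (E X).trace = X.trace)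
    (hR : R < mapEntropy E) {ε : ℝ} (hε : 0 < ε) :
    ∀ᶠ n : ℕ in atTop, ∀ m : ℕ, (m : ℝ) ≤ n * R →
      ∀ τ : (Fin n → ι) → Matrix (Fin (2 ^ m)) (Fin (2 ^ m)) ℂ,
        (∀ x, 0 ≤ τ x) → (∀ x, (τ x).trace ≤ 1) →
      ∀ D : Matrix (Fin (2 ^ m)) (Fin (2 ^ m)) ℂ →ₗ[ℂ]
          Matrix ((Fin n → d) × (Fin n → d)) ((Fin n → d) × (Fin n → d)) ℂ, IsCPTP D →
        ∑ x : Fin n → ι, krausWeight (tensorOp fun t => M (x t)) *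
          pureFidelity (krausState (tensorOp fun t => M (x t))) (D (τ x)) ≤ ε := by
  classical
  obtain ⟨a, hRa, haS⟩ := exists_between hR
  rw [hM.mapEntropy_eq] at haS
  have htail := tendsto_sum_lt_prod_of_lt_entropy (fun μ => krausWeight_nonneg (M μ))
    (hM.isKraus.sum_krausWeight hE) haS
  have hgeom : Tendsto (fun n : ℕ => ((2 : ℝ) ^ (R - a)) ^ n) atTop (𝓝 0) :=
    tendsto_pow_atTop_nhds_zero_of_lt_one (by positivity)
      (Real.rpow_lt_one_of_one_lt_of_neg one_lt_two (sub_neg.2 hRa))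
  have hlim := htail.add hgeom
  rw [add_zero] at hlim
  filter_upwards [hlim.eventually_le_const hε] with n hn m hm τ hτ hτtr D hD
  have hdim : (2 : ℝ) ^ (-(n * a)) * Fintype.card (Fin (2 ^ m)) ≤ ((2 : ℝ) ^ (R - a)) ^ n := by
    rw [Fintype.card_fin, Nat.cast_pow, Nat.cast_ofNat, ← Real.rpow_natCast, ← Real.rpow_natCast,
      ← Real.rpow_mul two_pos.le, ← Real.rpow_add two_pos]
    exact Real.rpow_le_rpow_of_exponent_le one_le_two (by linarith)
  refine (sum_mul_pureFidelity_le (sum_vecMulVec_krausState_le_one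
    fun x y => (hM.tensorMap_tensorOp n).trace_orthogonal x y) (fun x => krausWeight_nonneg _) hτ
    hτtr hD (by positivity)).trans ((add_le_add_right hdim _).trans ?_)
  simpa only [krausWeight_tensorOp] using hn

theorem mapEntropy_le_of_isAchievableRate (hE : IsCPTP E) (hR : IsAchievableRate E R) :
    mapEntropy E ≤ R := by
  by_contra! hlt
  obtain ⟨r, M, hM⟩ := exists_isDiagonalKraus hE.posSemidef_choiState
  obtain ⟨n, hconv, m, hm, C, hC⟩ := ((hM.eventually_sum_mul_pureFidelity_le hE.trace_preserving
    hlt (ε := 1 / 4) (by norm_num)).and (hR (1 / 2) (by norm_num))).exists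
  have hfidelity := hC r (fun _ => M) fun _ => hM.isKraus
  let ρ (x : Fin n → Fin r) := vecMulVec (krausState (tensorOp fun t => M (x t)))
    (star (krausState (tensorOp fun t => M (x t))))
  have hρ (x : Fin n → Fin r) : 0 ≤ ρ x := (posSemidef_vecMulVec_self_star _).nonneg
  have hρtr (x : Fin n → Fin r) : (ρ x).trace ≤ 1 := by
    rw [trace_vecMulVec, dotProduct_comm]
    exact star_krausState_dotProduct_self_le_one _
  have hupper := hconv m hm (fun x => C.encode (ρ x)) (fun x => C.encode_cptp.map_nonneg (hρ x))
    (fun x => (C.encode_cptp.trace_preserving _).trans_le (hρtr x)) C.decode C.decode_cptp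
  exact absurd (hfidelity.trans hupper) (by norm_num)

theorem isAchievableRate_of_mapEntropy_lt (hE : IsCPTP E) (hR : mapEntropy E < R) :
    IsAchievableRate E R := by
  classical
  intro ε hε
  obtain ⟨r, M, hM⟩ := exists_isDiagonalKraus hE.posSemidef_choiState
  obtain ⟨a, haS, haR⟩ := exists_between hR
  have hR₀ : 0 < R := hE.mapEntropy_nonneg.trans_lt hR
  rw [hM.mapEntropy_eq] at haS
  have htail := tendsto_sum_prod_lt_of_entropy_lt (fun μ => krausWeight_nonneg (M μ))
    (hM.isKraus.sum_krausWeight hE.trace_preserving) haS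
  have hroom : ∀ᶠ n : ℕ in atTop, 1 ≤ n * (R - a) :=
    (tendsto_natCast_atTop_atTop.atTop_mul_const (sub_pos.2 haR)).eventually_ge_atTop 1
  filter_upwards [htail.eventually_le_const (half_pos hε), hroom] with n hn hroom
  have hMn := hM.tensorMap_tensorOp n
  have hEn := trace_tensorMap fun _ : Fin n => hE.trace_preserving
  have hsum := hMn.isKraus.sum_krausWeight hEn
  have hcard : Finset.card {x : Fin n → Fin r |
      (2 : ℝ) ^ (-(n * a)) ≤ krausWeight (tensorOp fun t => M (x t))} ≤
        Fintype.card (Fin (2 ^ ⌊n * R⌋₊)) := by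
    rw [Fintype.card_fin, ← Nat.cast_le (α := ℝ), Nat.cast_pow, Nat.cast_ofNat,
      ← Real.rpow_natCast]
    refine (card_filter_rpow_neg_le_le_rpow (fun x => krausWeight_nonneg _) hsum.le _).trans
      (Real.rpow_le_rpow_of_exponent_le one_le_two ?_)
    linarith [Nat.lt_floor_add_one (n * R)]
  obtain ⟨C, D, hC, hD, hCD⟩ := hMn.exists_isCPTP_two_mul_sum_sub_one_le hEn hcard
  refine ⟨⌊n * R⌋₊, Nat.floor_le (by positivity), ⟨C, D, hC, hD⟩, fun s N hN => ?_⟩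
  refine le_trans ?_ (hCD _ _ (isKraus_tensorMap hN))
  rw [← Finset.sum_filter_add_sum_filter_not _
    fun x => (2 : ℝ) ^ (-(n * a)) ≤ krausWeight (tensorOp fun t => M (x t))] at hsum
  simp only [not_le, krausWeight_tensorOp] at hsum ⊢
  linarith

theorem isGLB_isAchievableRate (hE : IsCPTP E) :
    IsGLB {R : ℝ | IsAchievableRate E R} (mapEntropy E) :=
  ⟨fun _ => mapEntropy_le_of_isAchievableRate hE, fun _ hb =>
    le_of_forall_gt_imp_ge_of_dense fun _ hR => hb (isAchievableRate_of_mapEntropy_lt hE hR)⟩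

end Rates

theorem mainTheorem2 {d : Type*} [Fintype d] [DecidableEq d] [Nonempty d]
    (E : Matrix d d ℂ →ₗ[ℂ] Matrix d d ℂ) (hE : IsCPTP E) :
    -- a diagonal Kraus representation exists
    (∃ (r : ℕ) (M : Fin r → Matrix d d ℂ), IsDiagonalKraus E M) ∧
    -- its weights form a probability distribution, which is the spectrum of the Choi state (up to
    -- zeros, with multiplicity), with eigenvectors `ψ_μ`; so its entropy depends on `E` only
    (∀ (r : ℕ) (M : Fin r → Matrix d d ℂ), IsDiagonalKraus E M →
      ∑ μ, krausWeight (M μ) = 1 ∧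
      (∀ μ ν, μ ≠ ν → star (krausState (M μ)) ⬝ᵥ krausState (M ν) = 0) ∧
      choiState E = ∑ μ, (krausWeight (M μ) : ℂ) •
        vecMulVec (krausState (M μ)) (star (krausState (M μ))) ∧
      (choiState E).charpoly.roots.filter (· ≠ 0) =
        (Finset.univ.val.map fun μ => (krausWeight (M μ) : ℂ)).filter (· ≠ 0) ∧
      mapEntropy E = -∑ μ, krausWeight (M μ) * Real.logb 2 (krausWeight (M μ))) ∧
    -- the entropy is the optimal rate, in qubits per use, of faithful storage
    IsGLB {R : ℝ | IsAchievableRate E R} (mapEntropy E) ∧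
    -- below the entropy, storage fails already for the sequences of a diagonal Kraus
    -- representation, for all large `n` and even if the encoder is told the sequence `x` and may
    -- store it in an arbitrary state `τ x`
    (∀ (r : ℕ) (M : Fin r → Matrix d d ℂ), IsDiagonalKraus E M → ∀ R : ℝ, R < mapEntropy E →
      ∃ ε : ℝ, 0 < ε ∧ ∀ᶠ n : ℕ in atTop, ∀ m : ℕ, (m : ℝ) ≤ n * R →
        ∀ τ : (Fin n → Fin r) → Matrix (Fin (2 ^ m)) (Fin (2 ^ m)) ℂ, (∀ x, IsDensity (τ x)) →
        ∀ D : Matrix (Fin (2 ^ m)) (Fin (2 ^ m)) ℂ →ₗ[ℂ]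
            Matrix ((Fin n → d) × (Fin n → d)) ((Fin n → d) × (Fin n → d)) ℂ, IsCPTP D →
          ∑ x : Fin n → Fin r, krausWeight (tensorOp fun t => M (x t)) *
            pureFidelity (krausState (tensorOp fun t => M (x t))) (D (τ x)) ≤ 1 - ε) := by
  refine ⟨exists_isDiagonalKraus hE.posSemidef_choiState, fun r M hM => ⟨?_, ?_, ?_, ?_, ?_⟩,
    isGLB_isAchievableRate hE, fun r M hM R hR => ⟨1 / 2, by norm_num, ?_⟩⟩
  · exact hM.isKraus.sum_krausWeight hE.trace_preserving
  · exact fun μ ν hμν => star_krausState_dotProduct_eq_zero (hM.trace_orthogonal μ ν hμν)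
  · simp only [krausWeight_smul_vecMulVec_krausState]
    exact isKraus_iff_choiState_eq.1 hM.isKraus
  · exact hM.filter_roots_charpoly
  · exact hM.mapEntropy_eq
  · filter_upwards [hM.eventually_sum_mul_pureFidelity_le hE.trace_preserving hR
      (ε := 1 - 1 / 2) (by norm_num)] with n hn m hm τ hτ D hD
    exact hn m hm τ (fun x => (hτ x).posSemidef.nonneg) (fun x => (hτ x).trace_eq_one.le) D hD
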